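/- Let $n\ge 2$ and let $H_n=\mathbb R^{2n+1}$ be the Heisenberg group with coordinates $(x^1,\dots,x^{2n},z)$ and multiplication $$(a,b,c)\circ(x,y,z)=\Big(a+x,\;b+y,\;c+z+\sum_{j=1}^n(b_jx_j-a_jy_j)\Big),\qquad x_j=x^j,\ y_j=x^{n+j}.$$ Its horizontal distribution has the orthonormal frame $\hat e_j=\partial_{x_j}+y_j\partial_z$, $\hat e_{n+j}=\partial_{y_j}-x_j\partial_z$ ($1\le j\le n$), and the horizontal (or $p$-)mean curvature of a level set of a function $\phi$ is $$H_\phi=\sum_{I=1}^{2n}\hat e_I\Big(\frac{\hat e_I\phi}{|d\phi|_*}\Big),\qquad |d\phi|_*=\Big(\sum_{I=1}^{2n}(\hat e_I\phi)^2\Big)^{1/2}\neq 0.$$ For a function $u=u(\eta^2,\dots,\eta^{2n},\tau)$, the intrinsic graph of $u$ is the hypersurface of points $(0,\eta^2,\dots,\eta^{2n},\tau)\circ(u(\eta^2,\dots,\eta^{2n},\tau),0,\dots,0)$, that is, $x^1=u$, $x^j=\eta^j$ for $2\le j\le 2n$, and $z=\tau+\eta^{n+1}u$. Its horizontal mean curvature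 is that of the zero set of the defining function $u(x^2,\dots,x^{2n},z-x^1x^{n+1})-x^1$. Let $W^u=(\mathring e_2,\dots,\mathring e_n,\mathring e^u_{n+1},\mathring e_{n+2},\dots,\mathring e_{2n})$, where $$\mathring e_j=\partial_{\eta^j}+\eta^{n+j}\partial_\tau,\qquad \mathring e_{n+j}=\partial_{\eta^{n+j}}-\eta^j\partial_\tau\quad(2\le j\le n),\qquad \mathring e^u_{n+1}=\partial_{\eta^{n+1}}-2u\,\partial_\tau .$$ **Theorem E.** Let $u$ and $v$ be $C^\infty$ functions of $(\eta^2,\dots,\eta^{2n},\tau)$ on an open neighborhood $U$ of a point $p_0\in\mathbb R^{2n}$. Assume that $v(p_0)=u(p_0)$, that $v_{\eta^{n+1}}(p_0)\ne 0$ and $u_{\eta^{n+1}}(p_0)\neq 0$, that $v\ge u$ in $U$, and that $$W^v\cdot\left(\frac{W^v(v)}{\sqrt{1+|W^v(v)|^2}}\right)\;\le\; W^u\cdot\left(\frac{W^u(u)}{\sqrt{1+|W^u(u)|^2}}\right)\qquad\text{in } U.$$ If the intrinsic graph of $v$ or the intrinsic graph of $u$ (over $U$) has constant horizontal mean curvature,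 then $v\equiv u$ in a neighborhood of $p_0$. -/

import Mathlib

open scoped ContDiff Topology

noncomputable section

/-- Points `(x_1, …, x_n, y_1, …, y_n, z)` of the Heisenberg group `H_n`
(`x_j = x^j`, `y_j = x^{n+j}`). -/
abbrev Heis (n : ℕ) : Type := (Fin n → ℝ) × (Fin n → ℝ) × ℝ

namespace Heis

variable {n : ℕ}

/-- The group multiplication
`(a, b, c) ∘ (x, y, z) = (a + x, b + y, c + z + ∑ (b_j x_j - a_j y_j))`. -/
def mul (p q : Heis n) : Heis n :=
  (p.1 + q.1, p.2.1 + q.2.1,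
    p.2.2 + q.2.2 + ∑ j, (p.2.1 j * q.1 j - p.1 j * q.2.1 j))

/-- The left-invariant orthonormal frame of the contact distribution:
`∂/∂x_j + y_j ∂/∂z` (index `inl j`) and `∂/∂y_j - x_j ∂/∂z` (index `inr j`). -/
def frame : Fin n ⊕ Fin n → Heis n → Heis n
  | Sum.inl j, p => (Pi.single j 1, 0, p.2.1 j)
  | Sum.inr j, p => (0, Pi.single j 1, -p.1 j)

/-- The derivative of `φ` along the `I`-th horizontal frame field. -/
def D (I : Fin n ⊕ Fin n) (φ : Heis n → ℝ) (p : Heis n) : ℝ :=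
  fderiv ℝ φ p (frame I p)

/-- The length `|dφ|_*` with respect to the subriemannian metric of `H_n`, that is, the length of
the subgradient of `φ`. -/
def normD (φ : Heis n → ℝ) (p : Heis n) : ℝ :=
  Real.sqrt (∑ I, D I φ p ^ 2)

/-- The horizontal (or p-)mean curvature `H_φ = div_b (∇_b φ / |∇_b φ|)` of the level sets of `φ`.
As the frame fields are divergence free for the volume form
`dx_1 ∧ … ∧ dx_n ∧ dy_1 ∧ … ∧ dy_n ∧ Θ`, this is the divergence of the horizontal unit normal. -/
def meanCurvature (φ : Heis n → ℝ) (p : Heis n) : ℝ :=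
  ∑ I, D I (fun q => D I φ q / normD φ q) p

end Heis

/-- The parameters `(η^2, …, η^n; η^{n+1}, …, η^{2n}; τ)` of an intrinsic graph in `H_n`,
`n = m + 1`.  With indices starting at `0`, `η^{j+2}` is `p.1 j` for `j < m`, and `η^{n+1+k}` is
`p.2.1 k` for `k < m + 1`. -/
abbrev GraphParam (m : ℕ) : Type := (Fin m → ℝ) × (Fin (m + 1) → ℝ) × ℝ

namespace IntrinsicGraph

variable {m : ℕ}

/-- The point `(0, η^2, …, η^{2n}, τ) ∘ (u(η, τ), 0, …, 0)` of the intrinsic graph of `u`. -/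
def point (u : GraphParam m → ℝ) (p : GraphParam m) : Heis (m + 1) :=
  Heis.mul (Fin.cons 0 p.1, p.2.1, p.2.2) (Pi.single 0 (u p), 0, 0)

/-- The parameters `η^j = x^j` (`2 ≤ j ≤ 2n`), `τ = z - x^{n+1} x^1` of a point of `H_n`. -/
def param (q : Heis (m + 1)) : GraphParam m :=
  (Fin.tail q.1, q.2.1, q.2.2 - q.2.1 0 * q.1 0)

/-- The defining function `u(η^2, …, η^{2n}, τ) - x^1` of the intrinsic graph of `u`. -/
def definingFunction (u : GraphParam m → ℝ) (q : Heis (m + 1)) : ℝ :=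
  u (param q) - q.1 0

/-- The intrinsic graph of `u` over `U` has constant horizontal (or p-)mean curvature. -/
def HasConstantMeanCurvature (u : GraphParam m → ℝ) (U : Set (GraphParam m)) : Prop :=
  ∃ c : ℝ, ∀ p ∈ U, Heis.meanCurvature (definingFunction u) (point u p) = c

/-- The vector fields that make up `W^u`: for `2 ≤ j ≤ n`, `∂/∂η^j + η^{n+j} ∂/∂τ`; then
`∂/∂η^{n+1} - 2 u ∂/∂τ`; then, for `2 ≤ j ≤ n`, `∂/∂η^{n+j} - η^j ∂/∂τ`. -/
def field (u : GraphParam m → ℝ) : Fin m ⊕ Fin (m + 1) → GraphParam m → GraphParam m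
  | Sum.inl j, p => (Pi.single j 1, 0, p.2.1 j.succ)
  | Sum.inr k, p =>
      (0, Pi.single k 1, (Fin.cons (-2 * u p) (fun j => -p.1 j) : Fin (m + 1) → ℝ) k)

/-- The `i`-th component of `W^u(f)`. -/
def W (u : GraphParam m → ℝ) (i : Fin m ⊕ Fin (m + 1)) (f : GraphParam m → ℝ)
    (p : GraphParam m) : ℝ :=
  fderiv ℝ f p (field u i p)

/-- `W^u · (W^u(u) / √(1 + |W^u(u)|²))`. -/
def curvatureOp (u : GraphParam m → ℝ) (p : GraphParam m) : ℝ :=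
  ∑ i, W u i (fun q => W u i u q / Real.sqrt (1 + ∑ k, W u k u q ^ 2)) p

/-- The partial derivative `u_{η^{n+1}}`. -/
def partialEta (u : GraphParam m → ℝ) (p : GraphParam m) : ℝ :=
  fderiv ℝ u p (0, Pi.single 0 1, 0)

end IntrinsicGraph

end

/-! The operator is degenerate elliptic: its principal part only sees second derivatives along the
fields of `W^u`. If one of these fields were not orthogonal to a proximal normal of the coincidence
set `{v = u}`, a barrier that is very convex along the field would, as in Hopf's lemma, touch
`v - u` from below, which the ellipticity forbids. Following Nagumo and Bony, a closed set is
invariant under the flow of a field that is orthogonal to its proximal normals. For `2 ≤ j ≤ n`, and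
such a `j` exists because `n ≥ 2`, the fields with the indices `j` and `n + j` do not depend on `u`,
have straight integral curves, and have a nonzero multiple of `∂/∂τ` as their commutator; so `∂/∂τ`
is orthogonal to the proximal normals as well. Together with the fields of `W^u` it spans the whole
space, so there are no nonzero proximal normals near `p₀`. A point near `p₀` outside a closed set
would produce one at its nearest point in the set, and therefore `v = u` near `p₀`. -/

noncomputable section

open Filter Set Metric
open scoped NNReal

set_option maxSynthPendingDepth 3

section MaximumPrinciple

variable {E : Type*} [NormedAddCommGroup E] [NormedSpace ℝ E]

theorem deriv_deriv_nonneg_of_isLocalMin {f : ℝ → ℝ} {x : ℝ} (hf : ContinuousAt f x)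
    (hmin : IsLocalMin f x) : 0 ≤ deriv (deriv f) x := by
  by_contra! hneg
  have hmax : IsLocalMax f x := isLocalMax_of_deriv_deriv_neg hneg hmin.deriv_eq_zero hf
  have hconst : f =ᶠ[𝓝 x] fun _ => f x := by
    filter_upwards [hmin, hmax] with y hy hy' using le_antisymm hy' hy
  simp [hconst.deriv.deriv_eq] at hneg

theorem hasDerivAt_add_smul (p y : E) (t : ℝ) : HasDerivAt (fun t : ℝ => p + t • y) y t := by
  simpa using ((hasDerivAt_id t).smul_const y).const_add p

theorem contDiffAt_one_fderiv {f : E → ℝ} {p : E} (hf : ContDiffAt ℝ 2 f p) :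
    ContDiffAt ℝ 1 (fderiv ℝ f) p :=
  hf.fderiv_right le_rfl

theorem deriv_deriv_comp_add_smul {f : E → ℝ} {p : E} (hf : ContDiffAt ℝ 2 f p) (y : E) :
    deriv (deriv fun t : ℝ => f (p + t • y)) 0 = fderiv ℝ (fderiv ℝ f) p y y := by
  have hline : Tendsto (fun t : ℝ => p + t • y) (𝓝 0) (𝓝 p) := by
    simpa using (hasDerivAt_add_smul p y 0).continuousAt.tendsto
  have hderiv : (deriv fun t : ℝ => f (p + t • y)) =ᶠ[𝓝 0] fun t => fderiv ℝ f (p + t • y) y := by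
    filter_upwards [hline.eventually (hf.eventually (by simp))] with t ht
    exact ((ht.differentiableAt (by simp)).hasFDerivAt.comp_hasDerivAt (f := fun t : ℝ => p + t • y)
      t (hasDerivAt_add_smul p y t)).deriv
  have hf' : HasFDerivAt (fderiv ℝ f) (fderiv ℝ (fderiv ℝ f) p) (p + (0 : ℝ) • y) := by
    simpa using ((contDiffAt_one_fderiv hf).differentiableAt one_ne_zero).hasFDerivAt
  have hderiv2 : HasDerivAt (fun t : ℝ => fderiv ℝ f (p + t • y)) (fderiv ℝ (fderiv ℝ f) p y) 0 :=
    hf'.comp_hasDerivAt (f := fun t : ℝ => p + t • y) 0 (hasDerivAt_add_smul p y 0)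
  rw [hderiv.deriv_eq]
  simpa using (hderiv2.clm_apply (hasDerivAt_const 0 y)).deriv

theorem fderiv_fderiv_nonneg_of_isLocalMin {f : E → ℝ} {p : E} (hf : ContDiffAt ℝ 2 f p)
    (hmin : IsLocalMin f p) (y : E) : 0 ≤ fderiv ℝ (fderiv ℝ f) p y y := by
  have hline : ContinuousAt (fun t : ℝ => p + t • y) 0 :=
    (hasDerivAt_add_smul p y 0).continuousAt
  rw [← deriv_deriv_comp_add_smul hf]
  refine deriv_deriv_nonneg_of_isLocalMin (hf.continuousAt.comp_of_eq hline (by simp)) ?_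
  exact IsLocalMin.comp_continuous (g := fun t : ℝ => p + t • y) (by simpa using hmin) hline

theorem eventually_forall_mul_lt {X : Type*} [TopologicalSpace X] {K : Set X} (hK : IsCompact K)
    {w h : X → ℝ} (hw : ContinuousOn w K) (hh : ContinuousOn h K) (hw0 : ∀ x ∈ K, 0 ≤ w x)
    (hneg : ∀ x ∈ K, w x = 0 → h x < 0) : ∀ᶠ ε : ℝ in 𝓝[>] 0, ∀ x ∈ K, ε * h x < w x := by
  rcases K.eq_empty_or_nonempty with rfl | hne
  · simp
  -- `max w (-h)` is positive on `K`, hence bounded below by some `δ > 0`.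
  obtain ⟨x₀, hx₀, hmin⟩ := hK.exists_isMinOn hne (hw.sup hh.neg)
  set δ := max (w x₀) (-h x₀)
  have hδ : 0 < δ := by
    rcases (hw0 x₀ hx₀).eq_or_lt with h0 | h0
    · exact lt_max_of_lt_right (neg_pos.2 (hneg x₀ hx₀ h0.symm))
    · exact lt_max_of_lt_left h0
  obtain ⟨C, hC⟩ := hK.exists_bound_of_continuousOn hh
  have hsmall : ∀ᶠ ε : ℝ in 𝓝[>] 0, ε * C < δ := by
    refine Tendsto.eventually_lt_const hδ (Tendsto.mono_left ?_ nhdsWithin_le_nhds)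
    simpa using (tendsto_id (x := 𝓝 (0 : ℝ))).mul_const C
  filter_upwards [hsmall, self_mem_nhdsWithin] with ε hεC (hε : 0 < ε) x hx
  have hδx : δ ≤ max (w x) (-h x) := hmin hx
  rcases le_max_iff.1 hδx with hwx | hhx
  · calc ε * h x ≤ ε * C := by gcongr; exact (le_abs_self _).trans (hC x hx)
      _ < δ := hεC
      _ ≤ w x := hwx
  · exact (mul_neg_of_pos_of_neg hε (by linarith)).trans_le (hw0 x hx)

theorem frequently_isLocalMin_sub_mul [FiniteDimensional ℝ E] {w h : E → ℝ} {z : E}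
    (hw : ∀ᶠ y in 𝓝 z, ContinuousAt w y) (hh : ∀ᶠ y in 𝓝 z, ContinuousAt h y)
    (hwz : DifferentiableAt ℝ w z)
    (hw0 : ∀ᶠ y in 𝓝 z, 0 ≤ w y) (hwz0 : w z = 0) (hhz : h z = 0) (hDh : fderiv ℝ h z ≠ 0)
    (hneg : ∀ᶠ y in 𝓝[≠] z, w y = 0 → h y < 0) :
    ∃ᶠ y in 𝓝 z, ∃ ε > 0, IsLocalMin (fun x => w x - ε * h x) y ∧ w y < ε * h y := by
  refine frequently_iff.2 fun {N} hN => ?_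
  obtain ⟨R, hR, hball⟩ := nhds_basis_closedBall.eventually_iff.1
    (((hw.and hh).and (hw0.and (eventually_nhdsWithin_iff.1 hneg))).and hN)
  have hwc : ContinuousOn w (closedBall z R) := fun y hy => (hball hy).1.1.1.continuousWithinAt
  have hhc : ContinuousOn h (closedBall z R) := fun y hy => (hball hy).1.1.2.continuousWithinAt
  have hsub : sphere z R ⊆ closedBall z R := sphere_subset_closedBall
  obtain ⟨ε, hεs, hε⟩ := ((eventually_forall_mul_lt (isCompact_sphere z R) (hwc.mono hsub)
    (hhc.mono hsub) (fun y hy => (hball (hsub hy)).1.2.1) fun y hy =>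
      (hball (hsub hy)).1.2.2 (ne_of_mem_sphere hy hR.ne')).and self_mem_nhdsWithin).exists
  have hzB : z ∈ closedBall z R := mem_closedBall_self hR.le
  obtain ⟨p, hpB, hpmin⟩ := (isCompact_closedBall z R).exists_isMinOn ⟨z, hzB⟩
    (hwc.sub (continuousOn_const.mul hhc) : ContinuousOn (fun y => w y - ε * h y) _)
  -- Otherwise `w - ε h` and `w` both have a local minimum at `z`, so `fderiv ℝ h z = 0`.
  have hp : w p - ε * h p < 0 := by
    by_contra! hp
    have hminf : IsLocalMin (fun y => w y - ε * h y) z := by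
      filter_upwards [closedBall_mem_nhds z hR] with y hy
      simpa [hwz0, hhz] using hp.trans (hpmin hy)
    have hminw : IsLocalMin w z := by simpa [IsLocalMin, IsMinFilter, hwz0] using hw0
    have hDf := hminf.fderiv_eq_zero
    have hhd : DifferentiableAt ℝ h z := by
      by_contra hhd
      exact hDh (fderiv_zero_of_not_differentiableAt hhd)
    rw [fderiv_fun_sub hwz (hhd.const_mul ε), hminw.fderiv_eq_zero, fderiv_const_mul hhd] at hDf
    exact hDh (by simpa [(show ε ≠ 0 from ne_of_gt hε)] using hDf)
  have hpball : p ∈ ball z R := by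
    refine lt_of_le_of_ne (mem_closedBall.1 hpB) fun hps => ?_
    linarith [hεs p hps]
  exact ⟨p, (hball hpB).2, ε, hε, hpmin.isLocalMin (closedBall_mem_nhds_of_mem hpball), by linarith⟩

variable (E) in
/-- First-order jets of real functions on `E`: a point, a value and a derivative. -/
abbrev FirstJet : Type _ := E × ℝ × (E →L[ℝ] ℝ)

/-- The first-order jet of `u` at `p`. -/
def firstJet (u : E → ℝ) (p : E) : FirstJet E := (p, u p, fderiv ℝ u p)

theorem continuousAt_firstJet {u : E → ℝ} {p : E} (hu : ContDiffAt ℝ 1 u p) :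
    ContinuousAt (firstJet u) p :=
  continuousAt_id.prodMk
    (hu.continuousAt.prodMk (hu.fderiv_right (m := 0) (by norm_num)).continuousAt)

theorem firstJet_eq_of_eventually_le {u v : E → ℝ} {p : E} (hu : DifferentiableAt ℝ u p)
    (hv : DifferentiableAt ℝ v p) (hle : ∀ᶠ y in 𝓝 p, u y ≤ v y) (huv : v p = u p) :
    firstJet v p = firstJet u p := by
  have hmin : IsLocalMin (fun y => v y - u y) p := by
    simpa [IsLocalMin, IsMinFilter, huv] using hle
  have hD := hmin.fderiv_eq_zero
  rw [fderiv_fun_sub hv hu, sub_eq_zero] at hD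
  rw [firstJet, firstJet, huv, hD]

variable (E) in
/-- A quasilinear second-order operator `u ↦ A(p, u, Du) (D²u) + b(p, u, Du)` whose principal part
`A` is nonnegative on nonnegative quadratic forms, but may be degenerate. -/
structure DegenerateEllipticOperator where
  /-- The linear functional `A(p, u, Du)` of the second derivative. -/
  principal : FirstJet E → (E →L[ℝ] E →L[ℝ] ℝ) →L[ℝ] ℝ
  /-- The lower-order term `b(p, u, Du)`. -/
  lower : FirstJet E → ℝ
  locallyLipschitz_principal : LocallyLipschitz principal
  locallyLipschitz_lower : LocallyLipschitz lower
  principal_nonneg : ∀ x M, (∀ y, 0 ≤ M y y) → 0 ≤ principal x M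

namespace DegenerateEllipticOperator

variable (Q : DegenerateEllipticOperator E)

/-- The operator `Q` as a function of the first-order jet and the second derivative. -/
def symbol (x : FirstJet E) (M : E →L[ℝ] E →L[ℝ] ℝ) : ℝ :=
  Q.principal x M + Q.lower x

/-- The value at `p` of the operator `Q` applied to `u`. -/
def eval (u : E → ℝ) (p : E) : ℝ :=
  Q.symbol (firstJet u p) (fderiv ℝ (fderiv ℝ u) p)

theorem symbol_add (x : FirstJet E) (M N : E →L[ℝ] E →L[ℝ] ℝ) :
    Q.symbol x (M + N) = Q.symbol x M + Q.principal x N := by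
  simp only [symbol, map_add]
  ring

theorem locallyLipschitz_symbol : LocallyLipschitz (Function.uncurry Q.symbol) := by
  have happly : LocallyLipschitz
      fun q : ((E →L[ℝ] E →L[ℝ] ℝ) →L[ℝ] ℝ) × (E →L[ℝ] E →L[ℝ] ℝ) => q.1 q.2 :=
    (contDiff_fst.clm_apply contDiff_snd).locallyLipschitz
  have hfst : LocallyLipschitz (Prod.fst : FirstJet E × (E →L[ℝ] E →L[ℝ] ℝ) → FirstJet E) :=
    LipschitzWith.prod_fst.locallyLipschitz
  exact (happly.comp ((Q.locallyLipschitz_principal.comp hfst).prodMk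
    LipschitzWith.prod_snd.locallyLipschitz)).add (Q.locallyLipschitz_lower.comp hfst)

theorem mul_principal_le_symbol_sub {u v h : E → ℝ} {ε : ℝ} {p : E} (hu : ContDiffAt ℝ 2 u p)
    (hv : ContDiffAt ℝ 2 v p) (hh : ContDiffAt ℝ 2 h p) (hQ : Q.eval v p ≤ Q.eval u p)
    (hmin : IsLocalMin (fun y => v y - u y - ε * h y) p) :
    ε * Q.principal (firstJet v p) (fderiv ℝ (fderiv ℝ h) p) ≤
      Q.symbol (firstJet u p) (fderiv ℝ (fderiv ℝ u) p) -
        Q.symbol (firstJet v p) (fderiv ℝ (fderiv ℝ u) p) := by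
  set f := fun y => v y - u y - ε * h y
  have hf : ContDiffAt ℝ 2 f p := (hv.sub hu).sub (contDiffAt_const.mul hh)
  have hDf : fderiv ℝ f =ᶠ[𝓝 p] fun y => fderiv ℝ v y - fderiv ℝ u y - ε • fderiv ℝ h y := by
    filter_upwards [hu.eventually (by simp), hv.eventually (by simp), hh.eventually (by simp)]
      with y huy hvy hhy
    have hd := hhy.differentiableAt (by simp)
    rw [fderiv_fun_sub ((hvy.sub huy).differentiableAt (by simp)) (hd.const_mul ε),
      fderiv_fun_sub (hvy.differentiableAt (by simp)) (huy.differentiableAt (by simp)),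
      fderiv_const_mul hd]
  have hD2 {g : E → ℝ} (hg : ContDiffAt ℝ 2 g p) : DifferentiableAt ℝ (fderiv ℝ g) p :=
    (contDiffAt_one_fderiv hg).differentiableAt one_ne_zero
  have hD2f : fderiv ℝ (fderiv ℝ v) p = fderiv ℝ (fderiv ℝ u) p +
      (ε • fderiv ℝ (fderiv ℝ h) p + fderiv ℝ (fderiv ℝ f) p) := by
    rw [hDf.fderiv_eq, fderiv_fun_sub ((hD2 hv).fun_sub (hD2 hu)) ((hD2 hh).fun_const_smul ε),
      fderiv_fun_sub (hD2 hv) (hD2 hu), fderiv_fun_const_smul (hD2 hh)]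
    abel
  have hpos := Q.principal_nonneg (firstJet v p) _ (fderiv_fderiv_nonneg_of_isLocalMin hf hmin)
  rw [eval, hD2f, symbol_add, map_add, map_smul, smul_eq_mul] at hQ
  have hQ' : _ ≤ Q.symbol (firstJet u p) (fderiv ℝ (fderiv ℝ u) p) := hQ
  linarith

theorem dist_firstJet_le {u v h : E → ℝ} {ε : ℝ} {p : E} (hu : DifferentiableAt ℝ u p)
    (hv : DifferentiableAt ℝ v p) (hh : DifferentiableAt ℝ h p) (hε : 0 ≤ ε) (hle : u p ≤ v p)
    (hlt : v p - u p ≤ ε * h p) (hmin : IsLocalMin (fun y => v y - u y - ε * h y) p) :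
    dist (firstJet u p) (firstJet v p) ≤ ε * max (h p) ‖fderiv ℝ h p‖ := by
  have hD : fderiv ℝ v p - fderiv ℝ u p = ε • fderiv ℝ h p := by
    have h0 := hmin.fderiv_eq_zero
    rwa [fderiv_fun_sub (hv.fun_sub hu) (hh.const_mul ε), fderiv_fun_sub hv hu,
      fderiv_const_mul hh, sub_eq_zero] at h0
  have hval : dist (u p) (v p) ≤ ε * h p := by
    rwa [dist_comm, Real.dist_eq, abs_of_nonneg (sub_nonneg.2 hle)]
  have hder : dist (fderiv ℝ u p) (fderiv ℝ v p) = ε * ‖fderiv ℝ h p‖ := by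
    rw [dist_comm, dist_eq_norm, hD, norm_smul, Real.norm_of_nonneg hε]
  rw [mul_max_of_nonneg _ _ hε, firstJet, firstJet, Prod.dist_eq, Prod.dist_eq, dist_self, hder,
    max_eq_right (le_max_of_le_right (by positivity))]
  exact max_le_max_right _ hval

variable {Q} {u v : E → ℝ} {z : E}

theorem eventually_symbol_sub_le (hu : ContDiffAt ℝ 2 u z) (hv : ContDiffAt ℝ 1 v z)
    (hjet : firstJet v z = firstJet u z) :
    ∃ C : ℝ≥0, ∀ᶠ y in 𝓝 z, Q.symbol (firstJet u y) (fderiv ℝ (fderiv ℝ u) y) -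
      Q.symbol (firstJet v y) (fderiv ℝ (fderiv ℝ u) y) ≤
        C * dist (firstJet u y) (firstJet v y) := by
  obtain ⟨C, s, hs, hC⟩ := Q.locallyLipschitz_symbol (firstJet u z, fderiv ℝ (fderiv ℝ u) z)
  have hD2 : ContinuousAt (fderiv ℝ (fderiv ℝ u)) z :=
    ((contDiffAt_one_fderiv hu).fderiv_right (m := 0) (by simp)).continuousAt
  have hs_u := ((continuousAt_firstJet (hu.of_le one_le_two)).prodMk hD2).eventually_mem hs
  have hs_v := ((continuousAt_firstJet hv).prodMk hD2).eventually_mem (by rwa [hjet])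
  refine ⟨C, ?_⟩
  filter_upwards [hs_u, hs_v] with y huy hvy
  simpa [Prod.dist_eq] using (le_abs_self _).trans (hC.dist_le_mul _ huy _ hvy)

theorem eventually_lt_principal {h : E → ℝ} {C : ℝ} (hu : ContDiffAt ℝ 1 u z)
    (hh : ContDiffAt ℝ 2 h z) (hhz : h z = 0)
    (hlt : C * ‖fderiv ℝ h z‖ < Q.principal (firstJet u z) (fderiv ℝ (fderiv ℝ h) z)) :
    ∀ᶠ y in 𝓝 z, C * max (h y) ‖fderiv ℝ h y‖ <
      Q.principal (firstJet u y) (fderiv ℝ (fderiv ℝ h) y) := by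
  have hDh := contDiffAt_one_fderiv hh
  refine (continuousAt_const.mul (hh.continuousAt.max hDh.continuousAt.norm)).eventually_lt
    ((Q.locallyLipschitz_principal.continuous.continuousAt.comp
      (continuousAt_firstJet hu)).clm_apply (hDh.fderiv_right (m := 0) (by simp)).continuousAt) ?_
  simpa [hhz] using hlt

variable [FiniteDimensional ℝ E]

/- At the points of contact of `u + ε h` with `v` the ellipticity gains `ε` times the principal part
of `D²h`, while the first-order jets of `u` and `v` differ only by `ε` times that of `h`. -/
theorem exists_principal_le_mul_norm (hu : ContDiffAt ℝ 2 u z) (hv : ContDiffAt ℝ 2 v z)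
    (hle : ∀ᶠ y in 𝓝 z, u y ≤ v y) (hQ : ∀ᶠ y in 𝓝 z, Q.eval v y ≤ Q.eval u y)
    (huv : v z = u z) :
    ∃ C : ℝ, ∀ h : E → ℝ, ContDiffAt ℝ 2 h z → h z = 0 → fderiv ℝ h z ≠ 0 →
      (∀ᶠ y in 𝓝[≠] z, v y = u y → h y < 0) →
      Q.principal (firstJet u z) (fderiv ℝ (fderiv ℝ h) z) ≤ C * ‖fderiv ℝ h z‖ := by
  have hjet : firstJet v z = firstJet u z :=
    firstJet_eq_of_eventually_le (hu.differentiableAt two_ne_zero) (hv.differentiableAt two_ne_zero)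
      hle huv
  obtain ⟨C, hC⟩ := eventually_symbol_sub_le (Q := Q) hu (hv.of_le one_le_two) hjet
  refine ⟨C, fun h hh hhz hDh hneg => ?_⟩
  by_contra! hlt
  have hgain := eventually_lt_principal (hv.of_le one_le_two) hh hhz (by rwa [hjet])
  have hC2 {g : E → ℝ} (hg : ContDiffAt ℝ 2 g z) : ∀ᶠ y in 𝓝 z, ContDiffAt ℝ 2 g y :=
    hg.eventually (by simp)
  have hcontact : ∃ᶠ y in 𝓝 z, ∃ ε > 0,
      IsLocalMin (fun x => v x - u x - ε * h x) y ∧ v y - u y < ε * h y := by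
    refine frequently_isLocalMin_sub_mul ?_ ?_ ((hv.sub hu).differentiableAt two_ne_zero) ?_
      (sub_eq_zero.2 huv) hhz hDh (by simpa only [sub_eq_zero] using hneg)
    · filter_upwards [hC2 hu, hC2 hv] with y huy hvy using (hvy.sub huy).continuousAt
    · filter_upwards [hC2 hh] with y hhy using hhy.continuousAt
    · filter_upwards [hle] with y hy using sub_nonneg.2 hy
  obtain ⟨y, ⟨ε, hε, hmin, hyε⟩, hCy, hgain, ⟨hQy, hley⟩, huy, hvy, hhy⟩ :=
    (hcontact.and_eventually (hC.and (hgain.and ((hQ.and hle).and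
      ((hC2 hu).and ((hC2 hv).and (hC2 hh))))))).exists
  have hbound := calc ε * Q.principal (firstJet v y) (fderiv ℝ (fderiv ℝ h) y)
    _ ≤ Q.symbol (firstJet u y) (fderiv ℝ (fderiv ℝ u) y) -
        Q.symbol (firstJet v y) (fderiv ℝ (fderiv ℝ u) y) :=
      Q.mul_principal_le_symbol_sub huy hvy hhy hQy hmin
    _ ≤ C * dist (firstJet u y) (firstJet v y) := hCy
    _ ≤ C * (ε * max (h y) ‖fderiv ℝ h y‖) := by
      gcongr
      exact dist_firstJet_le (huy.differentiableAt two_ne_zero) (hvy.differentiableAt two_ne_zero)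
        (hhy.differentiableAt two_ne_zero) hε.le hley hyε.le hmin
    _ = ε * (C * max (h y) ‖fderiv ℝ h y‖) := by ring
  exact absurd (le_of_mul_le_mul_left hbound hε) (not_le.2 hgain)

end DegenerateEllipticOperator

/-- The function `c t² / 2 - t` of `t = g - g z`: negative where `g` is slightly larger than `g z`,
with gradient `-Dg` at `z` and, for large `c`, very convex in that direction. -/
def barrier {X : Type*} (g : X → ℝ) (z : X) (c : ℝ) (y : X) : ℝ :=
  c / 2 * (g y - g z) ^ 2 - (g y - g z)

theorem eventually_barrier_neg {X : Type*} [TopologicalSpace X] {g : X → ℝ} {z : X}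
    (hg : ContinuousAt g z) (c : ℝ) : ∀ᶠ y in 𝓝 z, g z < g y → barrier g z c y < 0 := by
  have hsmall : ∀ᶠ y in 𝓝 z, c / 2 * (g y - g z) < 1 := by
    refine (continuousAt_const.mul (hg.sub continuousAt_const)).eventually_lt continuousAt_const ?_
    simp
  filter_upwards [hsmall] with y hy hlt
  have hfactor : barrier g z c y = (g y - g z) * (c / 2 * (g y - g z) - 1) := by
    rw [barrier]
    ring
  exact hfactor ▸ mul_neg_of_pos_of_neg (sub_pos.2 hlt) (sub_neg.2 hy)

section Barrier

variable {g : E → ℝ} {z : E}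

theorem fderiv_barrier {y : E} (hg : DifferentiableAt ℝ g y) (z : E) (c : ℝ) :
    fderiv ℝ (barrier g z c) y = (c * (g y - g z) - 1) • fderiv ℝ g y := by
  have hsub := hg.hasFDerivAt.sub_const (g z)
  refine (((hsub.pow 2).const_mul (c / 2)).sub hsub).fderiv.trans ?_
  ext w
  simp only [Nat.add_one_sub_one, pow_one, nsmul_eq_mul, Nat.cast_ofNat, sub_apply, smul_apply,
    smul_eq_mul]
  ring

theorem fderiv_barrier_self (hg : DifferentiableAt ℝ g z) (c : ℝ) :
    fderiv ℝ (barrier g z c) z = -fderiv ℝ g z := by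
  simp [fderiv_barrier hg]

theorem fderiv_fderiv_barrier_self (hg : ContDiffAt ℝ 2 g z) (c : ℝ) :
    fderiv ℝ (fderiv ℝ (barrier g z c)) z =
      c • (fderiv ℝ g z).smulRight (fderiv ℝ g z) - fderiv ℝ (fderiv ℝ g) z := by
  have hderiv : fderiv ℝ (barrier g z c) =ᶠ[𝓝 z]
      fun y => (c * (g y - g z) - 1) • fderiv ℝ g y := by
    filter_upwards [hg.eventually (by simp)] with y hy
    exact fderiv_barrier (hy.differentiableAt two_ne_zero) z c
  have hD := (hg.differentiableAt two_ne_zero).hasFDerivAt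
  have hD2 := ((contDiffAt_one_fderiv hg).differentiableAt one_ne_zero).hasFDerivAt
  rw [hderiv.fderiv_eq, ((((hD.sub_const (g z)).const_mul c).sub_const 1).fun_smul hD2).fderiv]
  ext w w'
  simp only [sub_self, mul_zero, zero_sub, neg_smul, one_smul, add_apply, neg_apply,
    ContinuousLinearMap.smulRight_apply, smul_apply, smul_eq_mul, sub_apply]
  ring

theorem contDiffAt_barrier (hg : ContDiffAt ℝ 2 g z) (c : ℝ) : ContDiffAt ℝ 2 (barrier g z c) z :=
  (contDiffAt_const.mul ((hg.sub contDiffAt_const).pow 2)).sub (hg.sub contDiffAt_const)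

end Barrier

namespace DegenerateEllipticOperator

variable [FiniteDimensional ℝ E] {Q : DegenerateEllipticOperator E} {u v g : E → ℝ} {z : E}

theorem principal_smulRight_nonpos_of_strict (hu : ContDiffAt ℝ 2 u z) (hv : ContDiffAt ℝ 2 v z)
    (hle : ∀ᶠ y in 𝓝 z, u y ≤ v y) (hQ : ∀ᶠ y in 𝓝 z, Q.eval v y ≤ Q.eval u y)
    (huv : v z = u z) (hg : ContDiffAt ℝ 2 g z) (hmin : ∀ᶠ y in 𝓝[≠] z, v y = u y → g z < g y) :
    Q.principal (firstJet u z) ((fderiv ℝ g z).smulRight (fderiv ℝ g z)) ≤ 0 := by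
  have hgz := hg.differentiableAt two_ne_zero
  rcases eq_or_ne (fderiv ℝ g z) 0 with hDg | hDg
  · simp [hDg]
  obtain ⟨C, hC⟩ := exists_principal_le_mul_norm hu hv hle hQ huv
  set P := Q.principal (firstJet u z)
  set a := P ((fderiv ℝ g z).smulRight (fderiv ℝ g z))
  have hbound (c : ℝ) : c * a ≤ C * ‖fderiv ℝ g z‖ + P (fderiv ℝ (fderiv ℝ g) z) := by
    have hP := hC (barrier g z c) (contDiffAt_barrier hg c) (by simp [barrier])
      (by simpa [fderiv_barrier_self hgz] using hDg) (by
        filter_upwards [hmin, nhdsWithin_le_nhds (eventually_barrier_neg hg.continuousAt c)]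
          with y hy hneg hvu using hneg (hy hvu))
    rw [fderiv_fderiv_barrier_self hg, fderiv_barrier_self hgz, norm_neg, map_sub, map_smul,
      smul_eq_mul] at hP
    exact sub_le_iff_le_add.1 hP
  by_contra! ha
  obtain ⟨c, hc⟩ := exists_gt ((C * ‖fderiv ℝ g z‖ + P (fderiv ℝ (fderiv ℝ g) z)) / a)
  exact absurd (hbound c) (not_le.2 ((div_lt_iff₀ ha).1 hc))

theorem principal_smulRight_nonpos (hu : ContDiffAt ℝ 2 u z) (hv : ContDiffAt ℝ 2 v z)
    (hle : ∀ᶠ y in 𝓝 z, u y ≤ v y) (hQ : ∀ᶠ y in 𝓝 z, Q.eval v y ≤ Q.eval u y)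
    (huv : v z = u z) (hg : ContDiffAt ℝ 2 g z) (hmin : ∀ᶠ y in 𝓝 z, v y = u y → g z ≤ g y) :
    Q.principal (firstJet u z) ((fderiv ℝ g z).smulRight (fderiv ℝ g z)) ≤ 0 := by
  have hκ : ContDiff ℝ 2 fun y : E => ‖toEuclidean (y - z)‖ ^ 2 :=
    (toEuclidean.contDiff.comp (contDiff_id.sub contDiff_const)).norm_sq ℝ
  have hDκ : fderiv ℝ (fun y : E => ‖toEuclidean (y - z)‖ ^ 2) z = 0 :=
    IsLocalMin.fderiv_eq_zero (Eventually.of_forall fun y => by simp)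
  have hD : fderiv ℝ (fun y => g y + ‖toEuclidean (y - z)‖ ^ 2) z = fderiv ℝ g z := by
    rw [fderiv_fun_add (hg.differentiableAt two_ne_zero)
      (hκ.contDiffAt.differentiableAt two_ne_zero), hDκ, add_zero]
  rw [← hD]
  refine principal_smulRight_nonpos_of_strict hu hv hle hQ huv (hg.add hκ.contDiffAt) ?_
  filter_upwards [nhdsWithin_le_nhds hmin, self_mem_nhdsWithin] with y hy hyz hvu
  have hpos : 0 < ‖toEuclidean (y - z)‖ := by simpa [sub_eq_zero] using hyz
  simpa using add_lt_add_of_le_of_lt (hy hvu) (pow_pos hpos 2)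

end DegenerateEllipticOperator

end MaximumPrinciple

section ProximalTangent

variable {E : Type*} [NormedAddCommGroup E] [NormedSpace ℝ E]

/-- The vectors annihilated by the gradient at `z` of every `C²` function whose restriction to `Z`
has a local minimum at `z`, that is, the annihilator of the proximal normals of `Z` at `z`. -/
def proximalTangent (Z : Set E) (z : E) : Submodule ℝ E where
  carrier := {V | ∀ g : E → ℝ, ContDiffAt ℝ 2 g z → IsLocalMinOn g Z z → fderiv ℝ g z V = 0}
  add_mem' hV hW g hg hmin := by rw [map_add, hV g hg hmin, hW g hg hmin, add_zero]
  zero_mem' _ _ _ := map_zero _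
  smul_mem' c V hV g hg hmin := by rw [map_smul, hV g hg hmin, smul_zero]

variable {Z : Set E} {z : E}

theorem fderiv_apply_eq_of_forall_line {F : Type*} [NormedAddCommGroup F] [NormedSpace ℝ F]
    {f : E → F} {V : E} {w : F} (hf : DifferentiableAt ℝ f z)
    (hline : ∀ t : ℝ, f (z + t • V) = f z + t • w) : fderiv ℝ f z V = w := by
  have hf' : HasFDerivAt f (fderiv ℝ f z) (z + (0 : ℝ) • V) := by simpa using hf.hasFDerivAt
  have hcomp : HasDerivAt (fun t : ℝ => f (z + t • V)) (fderiv ℝ f z V) 0 :=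
    hf'.comp_hasDerivAt (f := fun t : ℝ => z + t • V) 0 (hasDerivAt_add_smul z V 0)
  rw [funext hline] at hcomp
  exact hcomp.unique (hasDerivAt_add_smul (f z) w 0)

theorem mem_proximalTangent_of_eventually_add_smul_mem {V : E}
    (hV : ∀ᶠ t : ℝ in 𝓝 0, z + t • V ∈ Z) : V ∈ proximalTangent Z z := by
  intro g hg hmin
  have hline : Tendsto (fun t : ℝ => z + t • V) (𝓝 0) (𝓝[Z] z) := by
    refine tendsto_nhdsWithin_iff.2 ⟨?_, hV⟩
    simpa using (hasDerivAt_add_smul z V 0).continuousAt.tendsto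
  have hmin' : IsLocalMin (fun t : ℝ => g (z + t • V)) 0 := by
    simpa [IsLocalMin, IsMinFilter] using hline.eventually hmin
  have hg' : HasFDerivAt g (fderiv ℝ g z) (z + (0 : ℝ) • V) := by
    simpa using (hg.differentiableAt two_ne_zero).hasFDerivAt
  exact hmin'.hasDerivAt_eq_zero
    (hg'.comp_hasDerivAt (f := fun t : ℝ => z + t • V) 0 (hasDerivAt_add_smul z V 0))

theorem exists_forall_lt_mul {X : Type*} [TopologicalSpace X] {K : Set X} (hK : IsCompact K)
    {s f : X → ℝ} (hs : ContinuousOn s K) (hf : ContinuousOn f K) (hpos : ∀ x ∈ K, 0 < f x) :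
    ∃ c : ℝ, 0 ≤ c ∧ ∀ x ∈ K, s x < c * f x := by
  obtain ⟨C, hC⟩ := hK.exists_bound_of_continuousOn (hs.div hf fun x hx => (hpos x hx).ne')
  refine ⟨|C| + 1, by positivity, fun x hx => (div_lt_iff₀ (hpos x hx)).1 ?_⟩
  calc s x / f x ≤ C := (le_abs_self _).trans (hC x hx)
    _ < |C| + 1 := (le_abs_self C).trans_lt (lt_add_one _)

/- Otherwise `π ≠ 0` on the part of `Z` in the far face `s = t` and in the lateral boundary of the
box; then `c ‖π‖² - s`, with `c` large, attains its minimum over `Z` at an interior point of the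
box, where it is a test function that is not constant along `V`. -/
theorem exists_mem_slice {F : Type*} [NormedAddCommGroup F] [InnerProductSpace ℝ F] {s : E → ℝ}
    {π : E → F} {t r : ℝ} (hs : ContDiff ℝ 2 s) (hπ : ContDiff ℝ 2 π) (ht : 0 ≤ t) (hr : 0 < r)
    (hK : IsCompact (Z ∩ {y | s y ∈ Icc 0 t ∧ ‖π y‖ ≤ r}))
    (htan : ∀ y ∈ Z, s y ∈ Icc 0 t → ‖π y‖ ≤ r →
      ∃ V ∈ proximalTangent Z y, fderiv ℝ s y V ≠ 0 ∧ fderiv ℝ π y V = 0)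
    (hz : z ∈ Z) (hsz : s z = 0) (hπz : π z = 0) : ∃ y ∈ Z, s y = t ∧ π y = 0 := by
  by_contra! hno
  have hbdry : IsClosed {y | s y = t ∨ ‖π y‖ = r} :=
    (isClosed_eq hs.continuous continuous_const).union
      (isClosed_eq hπ.continuous.norm continuous_const)
  obtain ⟨c, hc, hcpos⟩ := exists_forall_lt_mul (hK.inter_right hbdry) hs.continuous.continuousOn
    (hπ.continuous.norm.pow 2).continuousOn (by
      rintro y ⟨⟨hyZ, -⟩, hyt | hyr⟩
      · exact pow_pos (norm_pos_iff.2 (hno y hyZ hyt)) 2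
      · exact pow_pos (hr.trans_eq hyr.symm) 2)
  set g : E → ℝ := fun y => c * ‖π y‖ ^ 2 - s y
  have hg : ContDiff ℝ 2 g := (contDiff_const.mul (hπ.norm_sq ℝ)).sub hs
  have hzK : z ∈ Z ∩ {y | s y ∈ Icc 0 t ∧ ‖π y‖ ≤ r} :=
    ⟨hz, ⟨hsz.ge, hsz.trans_le ht⟩, by simp [hπz, hr.le]⟩
  obtain ⟨y, ⟨hyZ, ⟨hy0, hyt⟩, hyr⟩, hymin⟩ := hK.exists_isMinOn ⟨z, hzK⟩ hg.continuous.continuousOn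
  have hgy : g y ≤ 0 := by simpa [g, hsz, hπz] using hymin hzK
  have hinterior : ¬(s y = t ∨ ‖π y‖ = r) := fun h =>
    absurd (hcpos y ⟨⟨hyZ, ⟨hy0, hyt⟩, hyr⟩, h⟩) (not_lt.2 (sub_nonpos.1 hgy))
  rw [not_or] at hinterior
  have hlocmin : IsLocalMinOn g Z y := by
    filter_upwards [self_mem_nhdsWithin, nhdsWithin_le_nhds
      (hs.continuous.continuousAt.eventually_lt continuousAt_const (hyt.lt_of_ne hinterior.1)),
      nhdsWithin_le_nhds (hπ.continuous.norm.continuousAt.eventually_lt continuousAt_const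
        (hyr.lt_of_ne hinterior.2))] with x hxZ hxt hxr
    rcases le_or_gt 0 (s x) with hx0 | hx0
    · exact hymin ⟨hxZ, ⟨hx0, hxt.le⟩, hxr.le⟩
    · exact hgy.trans (sub_nonneg.2 (hx0.le.trans (by positivity)))
  obtain ⟨V, hV, hsV, hπV⟩ := htan y hyZ ⟨hy0, hyt⟩ hyr
  have hgV : fderiv ℝ g y V = -fderiv ℝ s y V := by
    have hD : HasFDerivAt g _ y :=
      (((hπ.differentiable two_ne_zero) y).hasFDerivAt.norm_sq.const_mul c).sub
        ((hs.differentiable two_ne_zero) y).hasFDerivAt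
    simp [hD.fderiv, hπV]
  exact hsV (neg_eq_zero.1 (hgV ▸ hV g hg.contDiffAt hlocmin))

end ProximalTangent

section StraightFlow

variable {E : Type*} [NormedAddCommGroup E] [NormedSpace ℝ E]

/-- The vector field `X` is constant along the straight lines `t ↦ y + t • X y`, which are then its
integral curves. -/
def IsStraight (X : E → E) : Prop :=
  ∀ y (t : ℝ), X (y + t • X y) = X y

/-- The time-`t` flow of a field with straight integral curves. -/
def lineFlow (X : E → E) (t : ℝ) (y : E) : E :=
  y + t • X y

/-- Near `p`, the set `Z` is invariant under the flow of the field `X` with straight integral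
curves, for small times of either sign. -/
def IsLocallyInvariantAt (Z : Set E) (X : E → E) (p : E) : Prop :=
  ∀ᶠ q : ℝ × E in 𝓝 (0, p), q.2 ∈ Z → lineFlow X q.1 q.2 ∈ Z

variable {X : E → E} {Z : Set E} {p : E}

theorem IsStraight.neg (hX : IsStraight X) : IsStraight (-X) := fun y t => by
  simpa using congr_arg Neg.neg (hX y (-t))

theorem lineFlow_neg (X : E → E) (t : ℝ) (y : E) : lineFlow (-X) t y = lineFlow X (-t) y := by
  simp [lineFlow]

theorem IsStraight.lineFlow_lineFlow (hX : IsStraight X) (s t : ℝ) (y : E) :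
    lineFlow X s (lineFlow X t y) = lineFlow X (s + t) y := by
  rw [lineFlow, lineFlow, lineFlow, hX y t, add_smul]
  abel

theorem continuous_lineFlow (hX : Continuous X) :
    Continuous fun q : ℝ × E => lineFlow X q.1 q.2 := by
  unfold lineFlow
  fun_prop

theorem IsLocallyInvariantAt.tendsto_lineFlow {α : Type*} {f : Filter α} {t : α → ℝ} {y : α → E}
    (hZ : IsLocallyInvariantAt Z X p) (hX : Continuous X) (ht : Tendsto t f (𝓝 0))
    (hy : Tendsto y f (𝓝[Z] p)) : Tendsto (fun a => lineFlow X (t a) (y a)) f (𝓝[Z] p) := by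
  rw [tendsto_nhdsWithin_iff] at hy ⊢
  have hty : Tendsto (fun a => (t a, y a)) f (𝓝 (0, p)) := ht.prodMk_nhds hy.1
  refine ⟨((continuous_lineFlow hX).tendsto' (0, p) p (by simp [lineFlow])).comp hty, ?_⟩
  filter_upwards [hty.eventually hZ, hy.2] with a ha hya using ha hya

variable [FiniteDimensional ℝ E]

/-- The coordinates of `y` transversal to the flow line of `X` through `z`: the point of the
hyperplane `l = l z` on the flow line of `y`, relative to `z`. -/
def flowCoord (X : E → E) (l : E →L[ℝ] ℝ) (z y : E) :
    EuclideanSpace ℝ (Fin (Module.finrank ℝ E)) :=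
  toEuclidean (lineFlow X (-l (y - z)) y - z)

theorem contDiff_flowCoord (hX : ContDiff ℝ 2 X) (l : E →L[ℝ] ℝ) (z : E) :
    ContDiff ℝ 2 (flowCoord X l z) := by
  unfold flowCoord lineFlow
  fun_prop

theorem lineFlow_flowCoord (hX : IsStraight X) (l : E →L[ℝ] ℝ) (z y : E) :
    lineFlow X (l (y - z)) (z + toEuclidean.symm (flowCoord X l z y)) = y := by
  rw [flowCoord, ContinuousLinearEquiv.symm_apply_apply, add_sub_cancel, hX.lineFlow_lineFlow,
    add_neg_cancel, lineFlow, zero_smul, add_zero]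

theorem flowCoord_add_smul (hX : IsStraight X) {l : E →L[ℝ] ℝ} {y : E} (hl : l (X y) = 1) (z : E)
    (t : ℝ) : flowCoord X l z (y + t • X y) = flowCoord X l z y := by
  have htime : l (y + t • X y - z) = l (y - z) + t := by
    simp [hl, add_sub_right_comm]
  have hflow := hX.lineFlow_lineFlow (-(l (y - z) + t)) t y
  rw [neg_add, add_assoc, neg_add_cancel, add_zero] at hflow
  rw [flowCoord, flowCoord, htime, neg_add]
  exact congr_arg (fun x => toEuclidean (x - z)) hflow

/-- The box of points that flow lines of `X` starting within distance `r` of `z` in the hyperplane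
`l = l z` reach in time at most `t`. -/
def flowBox (X : E → E) (l : E →L[ℝ] ℝ) (z : E) (t r : ℝ) : Set E :=
  {y | l (y - z) ∈ Icc 0 t ∧ ‖flowCoord X l z y‖ ≤ r}

theorem isCompact_flowBox (hX : IsStraight X) (hX2 : ContDiff ℝ 2 X) (l : E →L[ℝ] ℝ) (z : E)
    (t r : ℝ) : IsCompact (flowBox X l z t r) := by
  have hflow := continuous_lineFlow hX2.continuous
  refine (((isCompact_Icc (a := 0) (b := t)).prod (isCompact_closedBall 0 r)).image
    (f := fun q : ℝ × EuclideanSpace ℝ (Fin (Module.finrank ℝ E)) =>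
      lineFlow X q.1 (z + toEuclidean.symm q.2)) ?_).of_isClosed_subset ?_ fun y hy => ?_
  · exact hflow.comp (f := fun q : ℝ × _ => (q.1, z + toEuclidean.symm q.2)) (by fun_prop)
  · exact (isClosed_Icc.preimage (by fun_prop)).inter
      (isClosed_le (contDiff_flowCoord hX2 l z).continuous.norm continuous_const)
  · exact ⟨(l (y - z), flowCoord X l z y), ⟨hy.1, by simpa using hy.2⟩,
      lineFlow_flowCoord hX l z y⟩

theorem exists_eventually_flowBox_subset (hX : IsStraight X) (hXc : Continuous X) (l : E →L[ℝ] ℝ)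
    {N : Set E} (hN : N ∈ 𝓝 p) :
    ∃ r > 0, ∀ᶠ q : ℝ × E in 𝓝 (0, p), flowBox X l q.2 q.1 r ⊆ N := by
  let F := EuclideanSpace ℝ (Fin (Module.finrank ℝ E))
  let Ψ : (ℝ × E) × F → E := fun q => lineFlow X q.1.1 (q.1.2 + toEuclidean.symm q.2)
  have hΨ : Continuous Ψ := (continuous_lineFlow hXc).comp
    (f := fun q : (ℝ × E) × F => (q.1.1, q.1.2 + toEuclidean.symm q.2)) (by fun_prop)
  have hΨN : ∀ᶠ q in 𝓝 (((0 : ℝ), p), (0 : F)), Ψ q ∈ N :=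
    (hΨ.tendsto' _ p (by simp [Ψ, lineFlow])).eventually hN
  obtain ⟨r, hr, hball⟩ := nhds_basis_closedBall.eventually_iff.1 hΨN
  refine ⟨r, hr, ?_⟩
  filter_upwards [closedBall_mem_nhds ((0 : ℝ), p) hr] with ⟨t, z⟩ htz y ⟨hyt, hyr⟩
  have hmem : ((l (y - z), z), flowCoord X l z y) ∈ closedBall (((0 : ℝ), p), (0 : F)) r := by
    simp only [mem_closedBall, Prod.dist_eq, max_le_iff, dist_zero_right] at htz ⊢
    refine ⟨⟨?_, htz.2⟩, hyr⟩
    rw [Real.norm_of_nonneg hyt.1]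
    exact hyt.2.trans ((Real.le_norm_self t).trans htz.1)
  exact lineFlow_flowCoord hX l z y ▸ hball hmem

theorem eventually_lineFlow_mem_of_nonneg (l : E →L[ℝ] ℝ) (hX : IsStraight X) (hX2 : ContDiff ℝ 2 X)
    (hl : ∀ y, l (X y) = 1) (hZ : IsClosed Z)
    (htan : ∀ᶠ y in 𝓝 p, y ∈ Z → X y ∈ proximalTangent Z y) :
    ∀ᶠ q : ℝ × E in 𝓝 (0, p), q.2 ∈ Z → 0 ≤ q.1 → lineFlow X q.1 q.2 ∈ Z := by
  obtain ⟨r, hr, hbox⟩ := exists_eventually_flowBox_subset hX hX2.continuous l htan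
  filter_upwards [hbox] with ⟨t, z⟩ hsub (hz : z ∈ Z) (ht : 0 ≤ t)
  have hs : ContDiff ℝ 2 fun y => l (y - z) := by fun_prop
  have hπ := contDiff_flowCoord hX2 l z
  have hslice : ∃ y ∈ Z, l (y - z) = t ∧ flowCoord X l z y = 0 := by
    refine exists_mem_slice hs hπ ht hr ((isCompact_flowBox hX hX2 l z t r).inter_left hZ)
      (fun y hyZ hyt hyr => ⟨X y, hsub ⟨hyt, hyr⟩ hyZ, ?_, ?_⟩) hz (by simp)
      (by simp [flowCoord, lineFlow])
    · rw [fderiv_apply_eq_of_forall_line (w := 1) (hs.differentiable two_ne_zero y)]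
      · exact one_ne_zero
      · intro σ
        simp [hl, add_sub_right_comm]
    · refine fderiv_apply_eq_of_forall_line (hπ.differentiable two_ne_zero y) fun σ => ?_
      rw [flowCoord_add_smul hX (hl y), smul_zero, add_zero]
  obtain ⟨y, hyZ, hyt, hy0⟩ := hslice
  have hy := lineFlow_flowCoord hX l z y
  rw [hyt, hy0, map_zero, add_zero] at hy
  exact hy ▸ hyZ

theorem isLocallyInvariantAt_of_mem_proximalTangent (l : E →L[ℝ] ℝ) (hX : IsStraight X)
    (hX2 : ContDiff ℝ 2 X) (hl : ∀ y, l (X y) = 1) (hZ : IsClosed Z)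
    (htan : ∀ᶠ y in 𝓝 p, y ∈ Z → X y ∈ proximalTangent Z y) : IsLocallyInvariantAt Z X p := by
  have hbackward := eventually_lineFlow_mem_of_nonneg (-l) hX.neg hX2.neg (by simp [hl]) hZ
    (htan.mono fun y hy hyZ => neg_mem (hy hyZ))
  have hneg : Tendsto (fun q : ℝ × E => (-q.1, q.2)) (𝓝 (0, p)) (𝓝 (0, p)) := by
    simpa using (continuous_fst.neg.prodMk continuous_snd : Continuous
      fun q : ℝ × E => (-q.1, q.2)).tendsto (0, p)
  filter_upwards [eventually_lineFlow_mem_of_nonneg l hX hX2 hl hZ htan, hneg.eventually hbackward]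
    with ⟨t, y⟩ hpos hneg hyZ
  rcases le_total 0 t with ht | ht
  · exact hpos hyZ ht
  · simpa [lineFlow_neg] using hneg hyZ (neg_nonneg.2 ht)

end StraightFlow

section ShearField

variable {E : Type*} [NormedAddCommGroup E] [NormedSpace ℝ E]

/-- The vector field `e + β • T`, whose integral curves are straight lines if the linear form `β`
vanishes at `e` and `T`. -/
def shearField (e T : E) (β : E →L[ℝ] ℝ) (y : E) : E :=
  e + β y • T

variable {e e₁ e₂ T : E} {β β₁ β₂ l l₁ l₂ : E →L[ℝ] ℝ} {Z : Set E} {z : E}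

theorem contDiff_shearField (e T : E) (β : E →L[ℝ] ℝ) {n : WithTop ℕ∞} :
    ContDiff ℝ n (shearField e T β) := by
  unfold shearField
  fun_prop

theorem isStraight_shearField (he : β e = 0) (hT : β T = 0) : IsStraight (shearField e T β) := by
  intro y t
  simp [shearField, he, hT]

theorem lineFlow_shearField_commutator (h₁ : β₁ e₁ = 0) (h₂ : β₂ e₂ = 0) (h₁T : β₁ T = 0)
    (h₂T : β₂ T = 0) (a b : ℝ) (z : E) :
    lineFlow (shearField e₂ T β₂) (-b) (lineFlow (shearField e₁ T β₁) (-a)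
      (lineFlow (shearField e₂ T β₂) b (lineFlow (shearField e₁ T β₁) a z))) =
        z + (a * b * (β₂ e₁ - β₁ e₂)) • T := by
  simp only [lineFlow, shearField, map_add, map_smul, h₁, h₂, h₁T, h₂T, smul_eq_mul]
  module

theorem mem_proximalTangent_of_isLocallyInvariantAt (h₁ : β₁ e₁ = 0) (h₂ : β₂ e₂ = 0)
    (h₁T : β₁ T = 0) (h₂T : β₂ T = 0) (hcomm : β₂ e₁ - β₁ e₂ ≠ 0)
    (hZ₁ : IsLocallyInvariantAt Z (shearField e₁ T β₁) z)
    (hZ₂ : IsLocallyInvariantAt Z (shearField e₂ T β₂) z) (hz : z ∈ Z) :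
    T ∈ proximalTangent Z z := by
  have hX₁ := (contDiff_shearField e₁ T β₁ (n := 0)).continuous
  have hX₂ := (contDiff_shearField e₂ T β₂ (n := 0)).continuous
  have ha : Tendsto (fun q : ℝ × ℝ => q.1) (𝓝 (0, 0)) (𝓝 0) := continuous_fst.tendsto _
  have hb : Tendsto (fun q : ℝ × ℝ => q.2) (𝓝 (0, 0)) (𝓝 0) := continuous_snd.tendsto _
  have hstart : Tendsto (fun _ : ℝ × ℝ => z) (𝓝 (0, 0)) (𝓝[Z] z) :=
    tendsto_nhdsWithin_iff.2 ⟨tendsto_const_nhds, Eventually.of_forall fun _ => hz⟩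
  have hcycle := hZ₂.tendsto_lineFlow hX₂ (by simpa using hb.neg) (hZ₁.tendsto_lineFlow hX₁
    (by simpa using ha.neg) (hZ₂.tendsto_lineFlow hX₂ hb (hZ₁.tendsto_lineFlow hX₁ ha hstart)))
  have hmem : ∀ᶠ q : ℝ × ℝ in 𝓝 (0, 0), z + (q.1 * q.2 * (β₂ e₁ - β₁ e₂)) • T ∈ Z := by
    filter_upwards [(tendsto_nhdsWithin_iff.1 hcycle).2] with q hq
    rwa [lineFlow_shearField_commutator h₁ h₂ h₁T h₂T] at hq
  have hmem' : ∀ᶠ a : ℝ in 𝓝[≠] 0, ∀ᶠ b : ℝ in 𝓝 0, z + (a * b * (β₂ e₁ - β₁ e₂)) • T ∈ Z :=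
    nhdsWithin_le_nhds hmem.curry_nhds
  obtain ⟨a, hmem_a, ha0 : a ≠ 0⟩ := (hmem'.and self_mem_nhdsWithin).exists
  have hscale : Tendsto (fun s : ℝ => s / (a * (β₂ e₁ - β₁ e₂))) (𝓝 0) (𝓝 0) := by
    simpa using (tendsto_id (x := 𝓝 (0 : ℝ))).div_const (a * (β₂ e₁ - β₁ e₂))
  refine mem_proximalTangent_of_eventually_add_smul_mem ?_
  filter_upwards [hscale.eventually hmem_a] with s hs
  have hsa : a * (s / (a * (β₂ e₁ - β₁ e₂))) * (β₂ e₁ - β₁ e₂) = s := by field_simp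
  rwa [hsa] at hs

theorem isLocallyInvariantAt_shearField [FiniteDimensional ℝ E] (hβe : β e = 0) (hβT : β T = 0)
    (hle : l e = 1) (hlT : l T = 0) (hZ : IsClosed Z)
    (htan : ∀ᶠ y in 𝓝 z, y ∈ Z → shearField e T β y ∈ proximalTangent Z y) :
    IsLocallyInvariantAt Z (shearField e T β) z :=
  isLocallyInvariantAt_of_mem_proximalTangent l (isStraight_shearField hβe hβT)
    (contDiff_shearField e T β) (by simp [shearField, hle, hlT]) hZ htan

end ShearField

theorem mem_nhds_of_proximalTangent_eq_top {E : Type*} [NormedAddCommGroup E] [NormedSpace ℝ E]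
    [FiniteDimensional ℝ E] {Z : Set E} {p : E} (hZ : IsClosed Z) (hp : p ∈ Z)
    (htop : ∀ᶠ z in 𝓝 p, z ∈ Z → proximalTangent Z z = ⊤) : Z ∈ 𝓝 p := by
  let L : E ≃L[ℝ] EuclideanSpace ℝ (Fin (Module.finrank ℝ E)) := toEuclidean
  have htop' : ∀ᶠ x in 𝓝 (L p), L.symm x ∈ Z → proximalTangent Z (L.symm x) = ⊤ :=
    (L.symm.continuous.tendsto' _ _ (L.symm_apply_apply p)).eventually htop
  obtain ⟨r, hr, hball⟩ := nhds_basis_ball.eventually_iff.1 htop'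
  filter_upwards [L.continuous.continuousAt.preimage_mem_nhds (ball_mem_nhds (L p) (half_pos hr))]
    with q (hq : dist (L q) (L p) < r / 2)
  obtain ⟨x, hxZ, hx⟩ := (hZ.preimage L.symm.continuous).exists_infDist_eq_dist
    ⟨L p, by simpa using hp⟩ (L q)
  have hnear {y : E} (hy : y ∈ Z) : dist (L q) x ≤ dist (L q) (L y) :=
    hx ▸ infDist_le_dist_of_mem (by simpa using hy)
  have hxr : x ∈ ball (L p) r := by
    have := dist_triangle_left x (L p) (L q)
    have := hnear hp
    rw [mem_ball]
    linarith
  have hD : HasFDerivAt (fun y => ‖L (y - q)‖ ^ 2) _ (L.symm x) :=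
    (L.hasFDerivAt.comp _ ((hasFDerivAt_id _).sub_const q)).norm_sq
  have hmin : IsLocalMinOn (fun y => ‖L (y - q)‖ ^ 2) Z (L.symm x) := by
    filter_upwards [self_mem_nhdsWithin] with y hy
    have := hnear hy
    rw [dist_comm, dist_eq_norm, dist_comm, dist_eq_norm] at this
    simp only [map_sub, ContinuousLinearEquiv.apply_symm_apply]
    gcongr
  have hzero : fderiv ℝ (fun y => ‖L (y - q)‖ ^ 2) (L.symm x) (L.symm x - q) = 0 :=
    (hball hxr hxZ).ge (Submodule.mem_top (x := L.symm x - q)) _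
      ((L.contDiff.comp (contDiff_id.sub contDiff_const)).norm_sq ℝ).contDiffAt hmin
  have hxq : L.symm x = q := by
    rw [hD.fderiv] at hzero
    have hinner : inner ℝ (L (L.symm x - q)) (L (L.symm x - q)) = 0 := by
      simpa [-map_sub] using hzero
    exact sub_eq_zero.1 (L.map_eq_zero_iff.1 (inner_self_eq_zero.1 hinner))
  exact hxq ▸ hxZ

section AreaElement

variable {ι : Type*} [Fintype ι]

/-- The area integrand `√(1 + |ξ|²)` of a graph with slopes `ξ`. -/
def areaElement (ξ : ι → ℝ) : ℝ := Real.sqrt (1 + ∑ k, ξ k ^ 2)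

/-- The Hessian of `areaElement`. -/
def areaHessian [DecidableEq ι] (ξ : ι → ℝ) (i k : ι) : ℝ :=
  (if i = k then 1 else 0) / areaElement ξ - ξ i * ξ k / areaElement ξ ^ 3

theorem areaElement_pos (ξ : ι → ℝ) : 0 < areaElement ξ :=
  Real.sqrt_pos.2 (by positivity)

theorem sq_areaElement (ξ : ι → ℝ) : areaElement ξ ^ 2 = 1 + ∑ k, ξ k ^ 2 :=
  Real.sq_sqrt (by positivity)

theorem contDiff_areaElement {n : WithTop ℕ∞} : ContDiff ℝ n (areaElement (ι := ι)) := by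
  refine ContDiff.sqrt (by fun_prop) fun ξ => ?_
  positivity

theorem contDiff_areaHessian [DecidableEq ι] {n : WithTop ℕ∞} (i k : ι) :
    ContDiff ℝ n fun ξ : ι → ℝ => areaHessian ξ i k :=
  (contDiff_const.div contDiff_areaElement fun ξ => (areaElement_pos ξ).ne').sub
    (((contDiff_apply ℝ ℝ i).mul (contDiff_apply ℝ ℝ k)).div (contDiff_areaElement.pow 3)
      fun ξ => (pow_pos (areaElement_pos ξ) 3).ne')

theorem sum_areaHessian_mul [DecidableEq ι] (ξ : ι → ℝ) (i : ι) (a : ι → ℝ) :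
    ∑ k, areaHessian ξ i k * a k =
      a i / areaElement ξ - ξ i * (∑ k, ξ k * a k) / areaElement ξ ^ 3 := by
  simp only [areaHessian, sub_mul, div_mul_eq_mul_div, ite_mul, one_mul, zero_mul,
    Finset.sum_sub_distrib, ← Finset.sum_div, Finset.sum_ite_eq, Finset.mem_univ, if_true,
    mul_assoc, ← Finset.mul_sum]

theorem sum_sum_apply_smul_sub_smul {E : Type*} [NormedAddCommGroup E] [NormedSpace ℝ E]
    (ξ : ι → ℝ) (X : ι → E) (N : E →L[ℝ] E →L[ℝ] ℝ) :
    ∑ i, ∑ k, N (ξ i • X k - ξ k • X i) (ξ i • X k - ξ k • X i) =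
      2 * ((∑ k, ξ k ^ 2) * ∑ i, N (X i) (X i) - ∑ i, ∑ k, ξ i * ξ k * N (X i) (X k)) := by
  have hexpand (i k : ι) : N (ξ i • X k - ξ k • X i) (ξ i • X k - ξ k • X i) =
      ξ i ^ 2 * N (X k) (X k) + ξ k ^ 2 * N (X i) (X i) - ξ i * ξ k * N (X i) (X k) -
        ξ k * ξ i * N (X k) (X i) := by
    simp only [map_sub, map_smul, sub_apply, smul_apply, smul_eq_mul]
    ring
  simp only [hexpand, Finset.sum_sub_distrib, Finset.sum_add_distrib]
  rw [Finset.sum_comm (f := fun i k => ξ k ^ 2 * N (X i) (X i)),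
    Finset.sum_comm (f := fun i k => ξ k * ξ i * N (X k) (X i)), ← Finset.sum_mul_sum]
  ring

theorem sum_div_le_sum_areaHessian_mul [DecidableEq ι] {E : Type*} [NormedAddCommGroup E]
    [NormedSpace ℝ E] (ξ : ι → ℝ) (X : ι → E) {N : E →L[ℝ] E →L[ℝ] ℝ} (hN : ∀ y, 0 ≤ N y y) :
    (∑ i, N (X i) (X i)) / areaElement ξ ^ 3 ≤
      ∑ i, ∑ k, areaHessian ξ i k * N (X i) (X k) := by
  have hlagrange : 0 ≤ ∑ i, ∑ k, N (ξ i • X k - ξ k • X i) (ξ i • X k - ξ k • X i) :=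
    Finset.sum_nonneg fun i _ => Finset.sum_nonneg fun k _ => hN _
  rw [sum_sum_apply_smul_sub_smul] at hlagrange
  have hσ := areaElement_pos ξ
  calc (∑ i, N (X i) (X i)) / areaElement ξ ^ 3
    _ ≤ (areaElement ξ ^ 2 * ∑ i, N (X i) (X i) - ∑ i, ∑ k, ξ i * ξ k * N (X i) (X k)) /
        areaElement ξ ^ 3 := by
      rw [sq_areaElement]
      gcongr
      linarith
    _ = (∑ i, N (X i) (X i)) / areaElement ξ -
        (∑ i, ∑ k, ξ i * ξ k * N (X i) (X k)) / areaElement ξ ^ 3 := by field_simp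
    _ = ∑ i, ∑ k, areaHessian ξ i k * N (X i) (X k) := by
      simp only [sum_areaHessian_mul, Finset.sum_sub_distrib, Finset.sum_div, Finset.mul_sum,
        mul_assoc]

section Derivative

variable {E : Type*} [NormedAddCommGroup E] [NormedSpace ℝ E] {f : ι → E → ℝ}
  {f' : ι → E →L[ℝ] ℝ} {p : E}

theorem hasFDerivAt_areaElement (hf : ∀ k, HasFDerivAt (f k) (f' k) p) :
    HasFDerivAt (fun q => areaElement fun k => f k q)
      ((areaElement fun k => f k p)⁻¹ • ∑ k, f k p • f' k) p := by
  have hsq : HasFDerivAt (fun q => 1 + ∑ k, f k q ^ 2) ((2 : ℝ) • ∑ k, f k p • f' k) p := by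
    refine ((HasFDerivAt.fun_sum fun k (_ : k ∈ Finset.univ) => (hf k).pow 2).const_add 1)
      |>.congr_fderiv ?_
    simp only [Nat.add_one_sub_one, pow_one, nsmul_eq_mul, Nat.cast_ofNat, Finset.smul_sum,
      mul_smul]
  refine (hsq.sqrt (by positivity)).congr_fderiv ?_
  rw [smul_smul]
  congr 1
  change 1 / (2 * areaElement fun k => f k p) * 2 = (areaElement fun k => f k p)⁻¹
  field_simp

theorem hasFDerivAt_div_areaElement [DecidableEq ι] (hf : ∀ k, HasFDerivAt (f k) (f' k) p)
    (i : ι) :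
    HasFDerivAt (fun q => f i q / areaElement fun k => f k q)
      (∑ k, areaHessian (fun k => f k p) i k • f' k) p := by
  have hσ := areaElement_pos fun k => f k p
  refine ((hf i).mul ((hasDerivAt_inv hσ.ne').comp_hasFDerivAt p
    (hasFDerivAt_areaElement hf))).congr_fderiv ?_
  ext y
  simp only [sum_apply, smul_apply, add_apply, smul_eq_mul, sum_areaHessian_mul,
    Function.comp_apply]
  field_simp
  ring

end Derivative

end AreaElement

namespace IntrinsicGraph

variable {m : ℕ}

/-- The constant part of the `i`-th field of `W^u`. -/
def baseDir : Fin m ⊕ Fin (m + 1) → GraphParam m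
  | Sum.inl j => (Pi.single j 1, 0, 0)
  | Sum.inr k => (0, Pi.single k 1, 0)

/-- The coordinate vector field `∂/∂τ`. -/
def vertical : GraphParam m := (0, 0, 1)

/-- The `∂/∂τ`-component of the `i`-th field of `W^u` at `p`, as a linear function of
`(p, u p)`. -/
def verticalCoeff : Fin m ⊕ Fin (m + 1) → GraphParam m × ℝ →L[ℝ] ℝ
  | Sum.inl j => (ContinuousLinearMap.proj j.succ).comp
      ((ContinuousLinearMap.fst ℝ (Fin (m + 1) → ℝ) ℝ).comp
        ((ContinuousLinearMap.snd ℝ _ _).comp (ContinuousLinearMap.fst ℝ _ _)))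
  | Sum.inr k => Fin.cases ((-2 : ℝ) • ContinuousLinearMap.snd ℝ (GraphParam m) ℝ)
      (fun j => -(ContinuousLinearMap.proj j).comp
        ((ContinuousLinearMap.fst ℝ (Fin m → ℝ) _).comp
          (ContinuousLinearMap.fst ℝ (GraphParam m) ℝ))) k

@[simp] theorem verticalCoeff_inl (j : Fin m) (q : GraphParam m × ℝ) :
    verticalCoeff (Sum.inl j) q = q.1.2.1 j.succ := rfl

@[simp] theorem verticalCoeff_inr_zero (q : GraphParam m × ℝ) :
    verticalCoeff (Sum.inr 0) q = -2 * q.2 := rfl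

@[simp] theorem verticalCoeff_inr_succ (j : Fin m) (q : GraphParam m × ℝ) :
    verticalCoeff (Sum.inr j.succ) q = -q.1.1 j := rfl

/-- The value of the `i`-th field of `W^u` at `q.1`, if `u` has the value `q.2` there. -/
def frameAt (i : Fin m ⊕ Fin (m + 1)) (q : GraphParam m × ℝ) : GraphParam m :=
  baseDir i + verticalCoeff i q • vertical

theorem field_eq_frameAt (u : GraphParam m → ℝ) (i : Fin m ⊕ Fin (m + 1)) (p : GraphParam m) :
    field u i p = frameAt i (p, u p) := by
  rcases i with j | k
  · simp [field, frameAt, baseDir, vertical]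
  · refine Fin.cases ?_ (fun j => ?_) k <;> simp [field, frameAt, baseDir, vertical]

theorem eq_sum_baseDir (y : GraphParam m) :
    y = ∑ j, y.1 j • baseDir (Sum.inl j) + ∑ k, y.2.1 k • baseDir (Sum.inr k) +
      y.2.2 • vertical := by
  refine Prod.ext ?_ (Prod.ext ?_ ?_)
  · ext j
    simp [baseDir, vertical, Prod.fst_sum, Finset.sum_apply, Pi.single_apply]
  · ext k
    simp [baseDir, vertical, Prod.fst_sum, Prod.snd_sum, Finset.sum_apply, Pi.single_apply]
  · simp [baseDir, vertical, Prod.snd_sum]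

theorem contDiff_frameAt {n : WithTop ℕ∞} (i : Fin m ⊕ Fin (m + 1)) :
    ContDiff ℝ n (frameAt (m := m) i) :=
  contDiff_const.add ((verticalCoeff i).contDiff.smul contDiff_const)

/-- The value of the `i`-th field of `W^u` at `p`, in terms of the first-order jet of `u` at `p`. -/
def jetFrame (i : Fin m ⊕ Fin (m + 1)) (x : FirstJet (GraphParam m)) : GraphParam m :=
  frameAt i (x.1, x.2.1)

/-- The components of `W^u(u)` at `p`, in terms of the first-order jet of `u` at `p`. -/
def jetSlope (x : FirstJet (GraphParam m)) (i : Fin m ⊕ Fin (m + 1)) : ℝ :=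
  x.2.2 (jetFrame i x)

theorem W_eq_jetSlope (u : GraphParam m → ℝ) (i : Fin m ⊕ Fin (m + 1)) (p : GraphParam m) :
    W u i u p = jetSlope (firstJet u p) i :=
  congr_arg (fderiv ℝ u p) (field_eq_frameAt u i p)

theorem contDiff_jetFrame {n : WithTop ℕ∞} (i : Fin m ⊕ Fin (m + 1)) :
    ContDiff ℝ n (jetFrame (m := m) i) :=
  (contDiff_frameAt i).comp (contDiff_fst.prodMk (contDiff_fst.comp contDiff_snd))

theorem contDiff_jetSlope {n : WithTop ℕ∞} : ContDiff ℝ n (jetSlope (m := m)) :=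
  contDiff_pi.2 fun i => (contDiff_snd.comp contDiff_snd).clm_apply (contDiff_jetFrame i)

theorem hasFDerivAt_W {u : GraphParam m → ℝ} {p : GraphParam m} (hu : ContDiffAt ℝ 2 u p)
    (k : Fin m ⊕ Fin (m + 1)) :
    HasFDerivAt (W u k u) ((fderiv ℝ (fderiv ℝ u) p).flip (frameAt k (p, u p)) +
      fderiv ℝ u p vertical •
        (verticalCoeff k).comp ((ContinuousLinearMap.id ℝ _).prod (fderiv ℝ u p))) p := by
  have hDu := ((contDiffAt_one_fderiv hu).differentiableAt one_ne_zero).hasFDerivAt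
  have hgraph := (hasFDerivAt_id p).prodMk (hu.differentiableAt two_ne_zero).hasFDerivAt
  have hframe : HasFDerivAt (fun q => frameAt k (q, u q)) _ p :=
    (((verticalCoeff k).hasFDerivAt.comp p hgraph).smul_const vertical).const_add (baseDir k)
  have hW : W u k u = fun q => fderiv ℝ u q (frameAt k (q, u q)) :=
    funext fun q => W_eq_jetSlope u k q
  rw [hW]
  refine (hDu.clm_apply hframe).congr_fderiv (ContinuousLinearMap.ext fun y => ?_)
  simp only [add_apply, ContinuousLinearMap.comp_apply, ContinuousLinearMap.smulRight_apply,
    ContinuousLinearMap.prod_apply, ContinuousLinearMap.id_apply, map_smul, smul_eq_mul,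
    ContinuousLinearMap.flip_apply, smul_apply]
  ring

/-- The operator `curvatureOp` as a degenerate elliptic operator. -/
def curvatureOperator (m : ℕ) : DegenerateEllipticOperator (GraphParam m) where
  principal x := ∑ i, ∑ k, areaHessian (jetSlope x) i k •
    (ContinuousLinearMap.apply ℝ ℝ (jetFrame k x)).comp
      (ContinuousLinearMap.apply ℝ (GraphParam m →L[ℝ] ℝ) (jetFrame i x))
  lower x := ∑ i, ∑ k, areaHessian (jetSlope x) i k *
    (x.2.2 vertical * verticalCoeff k (jetFrame i x, jetSlope x i))
  locallyLipschitz_principal := by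
    refine ContDiff.locallyLipschitz (𝕂 := ℝ) (contDiff_clm_apply_iff.2 fun M => ?_)
    simp only [sum_apply, smul_apply]
    refine ContDiff.sum fun i _ => ContDiff.sum fun k _ =>
      ((contDiff_areaHessian i k).comp contDiff_jetSlope).smul ?_
    exact (contDiff_const.clm_apply (contDiff_jetFrame i)).clm_apply (contDiff_jetFrame k)
  locallyLipschitz_lower := by
    refine ContDiff.locallyLipschitz (𝕂 := ℝ) (ContDiff.sum fun i _ => ContDiff.sum fun k _ =>
      ((contDiff_areaHessian i k).comp contDiff_jetSlope).mul (ContDiff.mul (by fun_prop) ?_))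
    exact (verticalCoeff k).contDiff.comp
      ((contDiff_jetFrame i).prodMk (contDiff_pi.1 contDiff_jetSlope i))
  principal_nonneg x M hM := by
    have hσ := areaElement_pos (jetSlope x)
    have hsum : 0 ≤ ∑ i, M (jetFrame i x) (jetFrame i x) := Finset.sum_nonneg fun i _ => hM _
    simp only [sum_apply, smul_apply]
    exact (by positivity : (0 : ℝ) ≤ _).trans (sum_div_le_sum_areaHessian_mul _ _ hM)

theorem curvatureOperator_principal_apply (x : FirstJet (GraphParam m))
    (M : GraphParam m →L[ℝ] GraphParam m →L[ℝ] ℝ) :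
    (curvatureOperator m).principal x M =
      ∑ i, ∑ k, areaHessian (jetSlope x) i k * M (jetFrame i x) (jetFrame k x) := by
  simp [curvatureOperator]

theorem curvatureOp_eq_eval {u : GraphParam m → ℝ} {p : GraphParam m} (hu : ContDiffAt ℝ 2 u p) :
    curvatureOp u p = (curvatureOperator m).eval u p := by
  let x := firstJet u p
  have hterm (i : Fin m ⊕ Fin (m + 1)) :
      W u i (fun q => W u i u q / areaElement fun k => W u k u q) p =
        ∑ k, areaHessian (jetSlope x) i k *
          (fderiv ℝ (fderiv ℝ u) p (jetFrame i x) (jetFrame k x) +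
            x.2.2 vertical * verticalCoeff k (jetFrame i x, jetSlope x i)) := by
    rw [W, (hasFDerivAt_div_areaElement (hasFDerivAt_W hu) i).fderiv, field_eq_frameAt]
    simp only [sum_apply, smul_apply, add_apply, smul_eq_mul, W_eq_jetSlope]
    rfl
  calc curvatureOp u p
    _ = ∑ i, W u i (fun q => W u i u q / areaElement fun k => W u k u q) p := rfl
    _ = (curvatureOperator m).principal x (fderiv ℝ (fderiv ℝ u) p) +
        (curvatureOperator m).lower x := by
      simp only [hterm, mul_add, Finset.sum_add_distrib, curvatureOperator_principal_apply]
      rfl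

theorem frameAt_mem_proximalTangent {u v : GraphParam m → ℝ} {z : GraphParam m}
    {Z : Set (GraphParam m)} (hu : ContDiffAt ℝ 2 u z) (hv : ContDiffAt ℝ 2 v z)
    (hle : ∀ᶠ p in 𝓝 z, u p ≤ v p) (hcurv : ∀ᶠ p in 𝓝 z, curvatureOp v p ≤ curvatureOp u p)
    (hZ : ∀ᶠ p in 𝓝 z, p ∈ Z ↔ v p = u p) (hz : z ∈ Z) (i : Fin m ⊕ Fin (m + 1)) :
    frameAt i (z, u z) ∈ proximalTangent Z z := by
  intro g hg hmin
  have hQ : ∀ᶠ p in 𝓝 z, (curvatureOperator m).eval v p ≤ (curvatureOperator m).eval u p := by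
    filter_upwards [hcurv, hu.eventually (by simp), hv.eventually (by simp)] with p hp hup hvp
    rwa [← curvatureOp_eq_eval hup, ← curvatureOp_eq_eval hvp]
  have hmin' : ∀ᶠ p in 𝓝 z, v p = u p → g z ≤ g p := by
    filter_upwards [eventually_nhdsWithin_iff.1 hmin, hZ] with p hp hpZ hvu using hp (hpZ.2 hvu)
  set M := (fderiv ℝ g z).smulRight (fderiv ℝ g z)
  have hM (y : GraphParam m) : M y y = fderiv ℝ g z y ^ 2 := by simp [M, sq]
  have hM0 (y : GraphParam m) : 0 ≤ M y y := hM y ▸ sq_nonneg _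
  have hprincipal : (curvatureOperator m).principal (firstJet u z) M ≤ 0 :=
    DegenerateEllipticOperator.principal_smulRight_nonpos hu hv hle hQ (hZ.self_of_nhds.1 hz) hg
      hmin'
  rw [curvatureOperator_principal_apply] at hprincipal
  have hsum := (sum_div_le_sum_areaHessian_mul _ _ hM0).trans hprincipal
  rw [div_le_iff₀ (pow_pos (areaElement_pos _) 3), zero_mul] at hsum
  have hMi := Finset.sum_eq_zero_iff_of_nonneg (fun k _ => hM0 (jetFrame k (firstJet u z)))
    |>.1 (hsum.antisymm (Finset.sum_nonneg fun k _ => hM0 _)) i (Finset.mem_univ i)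
  exact pow_eq_zero_iff two_ne_zero |>.1 (hM _ ▸ hMi)

/-- The `∂/∂τ`-component of the `i`-th field of `W^u`, for the indices `i` of the fields that do not
depend on `u`. -/
def freeCoeff (i : Fin m ⊕ Fin (m + 1)) : GraphParam m →L[ℝ] ℝ :=
  (verticalCoeff i).comp (ContinuousLinearMap.inl ℝ _ _)

theorem vertical_mem_proximalTangent (hm : 1 ≤ m) {Z : Set (GraphParam m)} (hZ : IsClosed Z)
    {u : GraphParam m → ℝ} {z : GraphParam m} (hz : z ∈ Z)
    (htan : ∀ᶠ y in 𝓝 z, y ∈ Z → ∀ i, frameAt i (y, u y) ∈ proximalTangent Z y) :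
    vertical ∈ proximalTangent Z z := by
  let j : Fin m := ⟨0, hm⟩
  let xdir : GraphParam m := baseDir (Sum.inl j)
  let ydir : GraphParam m := baseDir (Sum.inr j.succ)
  let xcoeff := freeCoeff (Sum.inl j)
  let ycoeff := freeCoeff (Sum.inr j.succ)
  have hx (y : GraphParam m) :
      frameAt (Sum.inl j) (y, u y) = shearField xdir vertical xcoeff y := by
    simp [frameAt, shearField, xdir, xcoeff, freeCoeff]
  have hy (y : GraphParam m) :
      frameAt (Sum.inr j.succ) (y, u y) = shearField ydir vertical ycoeff y := by
    simp [frameAt, shearField, ydir, ycoeff, freeCoeff]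
  have hxx : xcoeff xdir = 0 := by simp [xcoeff, xdir, freeCoeff, baseDir]
  have hyy : ycoeff ydir = 0 := by simp [ycoeff, ydir, freeCoeff, baseDir]
  have hyx : ycoeff xdir = -1 := by simp [ycoeff, xdir, freeCoeff, baseDir]
  have hxy : xcoeff ydir = 1 := by simp [xcoeff, ydir, freeCoeff, baseDir]
  have hxT : xcoeff vertical = 0 := by simp [xcoeff, freeCoeff, vertical]
  have hyT : ycoeff vertical = 0 := by simp [ycoeff, freeCoeff, vertical]
  refine mem_proximalTangent_of_isLocallyInvariantAt hxx hyy hxT hyT (by norm_num [hxy, hyx])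
    (isLocallyInvariantAt_shearField (l := -ycoeff) hxx hxT (by simp [hyx]) (by simp [hyT]) hZ ?_)
    (isLocallyInvariantAt_shearField (l := xcoeff) hyy hyT hxy hxT hZ ?_) hz
  · exact htan.mono fun y h hyZ => hx y ▸ h hyZ _
  · exact htan.mono fun y h hyZ => hy y ▸ h hyZ _

theorem eq_top_of_frameAt_mem {S : Submodule ℝ (GraphParam m)} {q : GraphParam m × ℝ}
    (hvert : vertical ∈ S) (hframe : ∀ i, frameAt i q ∈ S) : S = ⊤ := by
  have hbase (i : Fin m ⊕ Fin (m + 1)) : baseDir i ∈ S := by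
    simpa [frameAt] using sub_mem (hframe i) (S.smul_mem (verticalCoeff i q) hvert)
  refine eq_top_iff.2 fun y _ => ?_
  rw [eq_sum_baseDir y]
  exact add_mem (add_mem (sum_mem fun j _ => S.smul_mem _ (hbase _))
    (sum_mem fun k _ => S.smul_mem _ (hbase _))) (S.smul_mem _ hvert)

end IntrinsicGraph

theorem theoremE_general {m : ℕ} (hm : 1 ≤ m) {u v : GraphParam m → ℝ} {p₀ : GraphParam m}
    (hu : ContDiffAt ℝ 2 u p₀) (hv : ContDiffAt ℝ 2 v p₀) (htouch : v p₀ = u p₀)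
    (hle : ∀ᶠ p in 𝓝 p₀, u p ≤ v p)
    (hcurv : ∀ᶠ p in 𝓝 p₀, IntrinsicGraph.curvatureOp v p ≤ IntrinsicGraph.curvatureOp u p) :
    ∀ᶠ p in 𝓝 p₀, v p = u p := by
  have hu2 := hu.eventually (by simp)
  have hv2 := hv.eventually (by simp)
  obtain ⟨R, hR, hball⟩ := nhds_basis_closedBall.eventually_iff.1 (hu2.and hv2)
  let Z := closedBall p₀ R ∩ {p | v p = u p}
  have hZ : IsClosed Z := by
    have hcont : ContinuousOn (fun p => v p - u p) (closedBall p₀ R) := fun p hp =>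
      ((hball hp).2.sub (hball hp).1).continuousAt.continuousWithinAt
    simpa [Z, preimage, sub_eq_zero] using
      hcont.preimage_isClosed_of_isClosed isClosed_closedBall (isClosed_singleton (x := (0 : ℝ)))
  have hmemZ : ∀ᶠ p in 𝓝 p₀, p ∈ Z ↔ v p = u p := by
    filter_upwards [closedBall_mem_nhds p₀ hR] with p hp using and_iff_right hp
  have htan : ∀ᶠ z in 𝓝 p₀, z ∈ Z → ∀ i,
      IntrinsicGraph.frameAt i (z, u z) ∈ proximalTangent Z z := by
    filter_upwards [hu2, hv2, hle.eventually_nhds, hcurv.eventually_nhds, hmemZ.eventually_nhds]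
      with z huz hvz hlez hcurvz hmemz hz i
    exact IntrinsicGraph.frameAt_mem_proximalTangent huz hvz hlez hcurvz hmemz hz i
  have htop : ∀ᶠ z in 𝓝 p₀, z ∈ Z → proximalTangent Z z = ⊤ := by
    filter_upwards [htan, htan.eventually_nhds] with z hframe htanz hz
    exact IntrinsicGraph.eq_top_of_frameAt_mem
      (IntrinsicGraph.vertical_mem_proximalTangent hm hZ hz htanz) (hframe hz)
  have hp₀ : p₀ ∈ Z := hmemZ.self_of_nhds.2 htouch
  filter_upwards [mem_nhds_of_proximalTangent_eq_top hZ hp₀ htop] with p hp using hp.2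

end

/-- Strong maximum principle for intrinsic graphs in the Heisenberg group `H_n`, `n = m + 1 ≥ 2`. -/
theorem theoremE (m : ℕ) (hn : 2 ≤ m + 1)
    (U : Set (GraphParam m)) (hU : IsOpen U) (p₀ : GraphParam m) (hp₀ : p₀ ∈ U)
    (u v : GraphParam m → ℝ) (hu : ContDiffOn ℝ ∞ u U) (hv : ContDiffOn ℝ ∞ v U)
    (htouch : v p₀ = u p₀)
    (hv' : IntrinsicGraph.partialEta v p₀ ≠ 0) (hu' : IntrinsicGraph.partialEta u p₀ ≠ 0)
    (hle : ∀ p ∈ U, u p ≤ v p)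
    (hcurv : ∀ p ∈ U, IntrinsicGraph.curvatureOp v p ≤ IntrinsicGraph.curvatureOp u p)
    (hconst : IntrinsicGraph.HasConstantMeanCurvature v U ∨
      IntrinsicGraph.HasConstantMeanCurvature u U) :
    ∀ᶠ p in 𝓝 p₀, v p = u p := by
  have hU₀ := hU.mem_nhds hp₀
  have hsmooth : (2 : WithTop ℕ∞) ≤ ∞ := WithTop.coe_le_coe.2 (le_top : (2 : ℕ∞) ≤ ⊤)
  exact theoremE_general (Nat.le_of_succ_le_succ hn) ((hu.contDiffAt hU₀).of_le hsmooth)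
    ((hv.contDiffAt hU₀).of_le hsmooth) htouch (Filter.eventually_of_mem hU₀ hle)
    (Filter.eventually_of_mem hU₀ hcurv)
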